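/- Let $G$ be a free product of finitely many cyclic groups (each finite or infinite), or an amalgamated free product $A *_C B$, where $A$ and $B$ are free products of finitely many cyclic groups and $C$ is a cyclic group embedded in both $A$ and $B$. Then $G$ is finitely generated, and the membership problem of $G$ with respect to cyclic subgroups is solvable: for every finite generating family $s_1,\dots,s_n$ of $G$ there is an algorithm which, given two words $w$ and $t$ in the letters $s_1^{\pm1},\dots,s_n^{\pm1}$, decides whether the element of $G$ represented by $w$ lies in the cyclic subgroup generated by the element represented by $t$. -/

import Mathlib

universe u

/-- `G` is (isomorphic to) a free product of finitely many cyclic groups, finite or infinite. -/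
def IsFreeProductOfCyclicGroups (G : Type u) [Group G] : Prop :=
  ∃ (n : ℕ) (H : Fin n → Type u) (_ : ∀ i, Group (H i)),
    (∀ i, IsCyclic (H i)) ∧ Nonempty (G ≃* Monoid.CoprodI H)

/-- `G` is (isomorphic to) a free product `P false *_C P true` with amalgamation over a cyclic
group `C`, embedded in both factors, each factor being a free product of finitely many cyclic
groups. -/
def IsCyclicAmalgamOfFreeProductsOfCyclicGroups (G : Type u) [Group G] : Prop :=
  ∃ (P : Bool → Type u) (_ : ∀ b, Group (P b)) (C : Type u) (_ : Group C)
    (φ : ∀ b, C →* P b),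
    (∀ b, IsFreeProductOfCyclicGroups (P b)) ∧ IsCyclic C ∧
      (∀ b, Function.Injective (φ b)) ∧ Nonempty (G ≃* Monoid.PushoutI φ)

/-- The element of `G` represented by a word in the letters `s i` (written `(i, true)`) and
`(s i)⁻¹` (written `(i, false)`). -/
def wordValue {G : Type u} [Group G] {n : ℕ} (s : Fin n → G) (w : List (Fin n × Bool)) : G :=
  (w.map fun x => if x.2 then s x.1 else (s x.1)⁻¹).prod

/-- The membership problem of the finitely generated group `G` with respect to cyclic subgroups is
solvable: for every finite generating family there is an algorithm which, given two words `w` and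
`t` in these generators, decides whether the element represented by `w` lies in the cyclic
subgroup generated by the element represented by `t`. -/
def HasSolvableCyclicMembershipProblem (G : Type u) [Group G] : Prop :=
  Group.FG G ∧
    ∀ (n : ℕ) (s : Fin n → G), Subgroup.closure (Set.range s) = ⊤ →
      ComputablePred fun p : List (Fin n × Bool) × List (Fin n × Bool) =>
        wordValue s p.1 ∈ Subgroup.zpowers (wordValue s p.2)

/-! Call a group good if its elements have codes with computable multiplication, decidable word
problem and decidable membership in cyclic subgroups. Cyclic groups are good. The main point
(`Monoid.PushoutI.exists_groupNumbering`) is that an amalgam of a finite nonempty family of good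
groups over an embedded cyclic group is good. Free products are amalgams over the trivial group, so
two applications suffice.

In a good factor the image of the cyclic group is a cyclic subgroup, so membership in it is
decidable and normal forms in the amalgam are computable. The sequence of factors met by a normal
form is an invariant of the element. Now let `t` be given. Up to conjugacy, either `t` lies in a
factor, and then so must `w`, so the question descends to that factor; or the normal form of `t`
begins and ends in different factors, the normal form of `t ^ n` has at least `n` syllables, and
only finitely many exponents are possible.

No conjugator has to be computed: a positive answer is certified by an exponent, a negative one by a
conjugator and the data above, and both kinds of certificate are searched for in parallel
(`ComputablePred.of_certificates`). -/

section Computability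

/-! ### Computable functions, predicates and unbounded search -/

variable {α β γ σ : Type*} [Primcodable α] [Primcodable β] [Primcodable γ] [Primcodable σ]

theorem ComputablePred.comp {p : β → Prop} {f : α → β} (hp : ComputablePred p)
    (hf : Computable f) : ComputablePred fun a => p (f a) := by
  obtain ⟨_, h⟩ := hp
  exact ⟨fun a => inferInstance, h.comp hf⟩

theorem ComputablePred.and {p q : α → Prop} (hp : ComputablePred p) (hq : ComputablePred q) :
    ComputablePred fun a => p a ∧ q a := by
  obtain ⟨_, hp⟩ := hp
  obtain ⟨_, hq⟩ := hq
  exact ⟨fun a => inferInstance, (Primrec.and.to_comp.comp hp hq).of_eq fun a => by simp⟩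

theorem ComputablePred.or {p q : α → Prop} (hp : ComputablePred p) (hq : ComputablePred q) :
    ComputablePred fun a => p a ∨ q a := by
  obtain ⟨_, hp⟩ := hp
  obtain ⟨_, hq⟩ := hq
  exact ⟨fun a => inferInstance, (Primrec.or.to_comp.comp hp hq).of_eq fun a => by simp⟩

theorem ComputablePred.eq {f g : α → β} (hf : Computable f) (hg : Computable g) :
    ComputablePred fun a => f a = g a := by
  classical
  exact (PrimrecPred.computablePred (Primrec.eq (α := β))).comp (hf.pair hg)

theorem Computable.if_then_else {c : α → Prop} [DecidablePred c] {f g : α → σ}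
    (hc : ComputablePred c) (hf : Computable f) (hg : Computable g) :
    Computable fun a => if c a then f a else g a :=
  (Computable.cond hc.decide hf hg).of_eq fun a => by by_cases h : c a <;> simp [h]

/-- Unbounded search: a computable relation that is total has a computable choice function. -/
theorem ComputablePred.exists_choice {q : α → β → Prop}
    (hq : ComputablePred fun p : α × β => q p.1 p.2) (h : ∀ a, ∃ b, q a b) :
    ∃ f : α → β, Computable f ∧ ∀ a, q a (f a) := by
  classical
  choose g hg using h
  let F : α → ℕ → Option β := fun a n =>
    (Encodable.decode (α := β) n).bind fun b => if q a b then some b else none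
  have hF : Computable₂ F := Computable.bind_decode_iff.2 <|
    Computable.if_then_else hq (Computable.option_some.comp Computable.snd) (Computable.const none)
  have hdom : ∀ a, (Nat.rfindOpt (F a)).Dom := fun a => Nat.rfindOpt_dom.2
    ⟨Encodable.encode (g a), g a, by simp [F, hg a]⟩
  refine ⟨fun a => (Nat.rfindOpt (F a)).get (hdom a),
    (Partrec.rfindOpt hF).of_eq_tot fun a => Part.get_mem _, fun a => ?_⟩
  obtain ⟨n, hn⟩ := Nat.rfindOpt_spec (Part.get_mem (hdom a))
  obtain ⟨b, -, hb⟩ := Option.bind_eq_some_iff.1 hn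
  split_ifs at hb with hqb
  exact Eq.subst (motive := q a) (Option.some.inj hb) hqb

/-- A predicate is computable if both it and its negation have computable certificates. -/
theorem ComputablePred.of_certificates {p : α → Prop} {q : α → β → Prop} {r : α → γ → Prop}
    (hq : ComputablePred fun x : α × β => q x.1 x.2)
    (hr : ComputablePred fun x : α × γ => r x.1 x.2)
    (hp : ∀ a, p a → ∃ b, q a b) (hp' : ∀ a, ¬ p a → ∃ c, r a c)
    (hqp : ∀ a b, q a b → p a) (hrp : ∀ a c, r a c → ¬ p a) : ComputablePred p := by
  classical
  -- Both kinds of certificate are searched for at once in the sum type; the side of the one found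
  -- is the answer.
  have hs : ComputablePred fun x : α × (β ⊕ γ) => Sum.elim (q x.1) (r x.1) x.2 := by
    refine ⟨inferInstance, (Computable.sumCasesOn Computable.snd
      (g := fun x b => decide (q x.1 b)) (h := fun x c => decide (r x.1 c)) ?_ ?_).of_eq ?_⟩
    · exact (hq.comp ((Computable.fst.comp Computable.fst).pair Computable.snd)).decide
    · exact (hr.comp ((Computable.fst.comp Computable.fst).pair Computable.snd)).decide
    · rintro ⟨a, b | c⟩ <;> rfl
  obtain ⟨f, hf, hfq⟩ := ComputablePred.exists_choice
    (q := fun a s => Sum.elim (q a) (r a) s) hs fun a => by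
    by_cases h : p a
    · obtain ⟨b, hb⟩ := hp a h
      exact ⟨Sum.inl b, hb⟩
    · obtain ⟨c, hc⟩ := hp' a h
      exact ⟨Sum.inr c, hc⟩
  refine ⟨inferInstance, (Computable.sumCasesOn hf (g := fun _ _ => true) (h := fun _ _ => false)
    (Computable.const true) (Computable.const false)).of_eq fun a => ?_⟩
  have := hfq a
  rcases h : f a with b | c <;> rw [h] at this
  · simpa using hqp a b this
  · simpa using hrp a c this

/-- The fold is a primitive recursion on the number of entries already read. The step need only be
computable, which is all that normal form reduction provides. -/
theorem Computable.list_foldl {f : α → List β} {g : α → σ} {h : α → σ × β → σ}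
    (hf : Computable f) (hg : Computable g) (hh : Computable₂ h) :
    Computable fun a => (f a).foldl (fun s b => h a (s, b)) (g a) := by
  have hstep : Computable₂ fun (a : α) (y : ℕ × σ) =>
      (Option.casesOn (f a)[y.1]? y.2 fun b => h a (y.2, b) : σ) := by
    refine Computable.option_casesOn
      (Computable.list_getElem?.comp (hf.comp Computable.fst)
        (Computable.fst.comp Computable.snd)) (Computable.snd.comp Computable.snd) ?_
    exact hh.comp (Computable.fst.comp Computable.fst)
      ((Computable.snd.comp (Computable.snd.comp Computable.fst)).pair Computable.snd)
  refine (Computable.nat_rec (Computable.list_length.comp hf) hg hstep).of_eq fun a => ?_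
  have : ∀ n ≤ (f a).length, (Nat.rec (motive := fun _ => σ) (g a) (fun y IH =>
      (Option.casesOn (f a)[y]? IH fun b => h a (IH, b) : σ)) n) =
        ((f a).take n).foldl (fun s b => h a (s, b)) (g a) := by
    intro n
    induction n with
    | zero => simp
    | succ n ih =>
      intro hn
      simp only [ih (by omega), List.take_add_one, List.foldl_append,
        List.getElem?_eq_getElem (show n < (f a).length by omega)]
      rfl
  simpa using this _ le_rfl

theorem Computable.list_foldr {f : α → List β} {g : α → σ} {h : α → β × σ → σ}
    (hf : Computable f) (hg : Computable g) (hh : Computable₂ h) :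
    Computable fun a => (f a).foldr (fun b s => h a (b, s)) (g a) :=
  (Computable.list_foldl (h := fun a x => h a (x.2, x.1)) (Computable.list_reverse.comp hf) hg
    (hh.comp Computable.fst ((Computable.snd.comp Computable.snd).pair
      (Computable.fst.comp Computable.snd)))).of_eq fun a => by simp

theorem Computable.list_map {f : β → γ} (hf : Computable f) :
    Computable fun l : List β => l.map f :=
  (Computable.list_foldr (h := fun _ x => f x.1 :: x.2) Computable.id (Computable.const [])
    (Computable.list_cons.comp (hf.comp (Computable.fst.comp Computable.snd))
      (Computable.snd.comp Computable.snd))).of_eq fun l => by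
        simp only [id]
        induction l <;> simp_all

/-- Finitely many computable functions form one computable function. -/
theorem Computable.of_finite_family {ι : Type*} [Primcodable ι] [Finite ι] [Nonempty σ]
    {f : ι → α → σ} (hf : ∀ i, Computable (f i)) : Computable fun x : ι × α => f x.1 x.2 := by
  classical
  have := Fintype.ofFinite ι
  obtain ⟨s⟩ := ‹Nonempty σ›
  -- No uniformity in `i` is needed: the finitely many programs are joined by comparing the index
  -- with each `i` in turn.
  have key : ∀ S : Finset ι, Computable fun x : ι × α => if x.1 ∈ S then f x.1 x.2 else s := by
    intro S
    induction S using Finset.induction_on with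
    | empty => simpa using Computable.const s
    | insert i S _ ih =>
      refine (Computable.if_then_else (c := fun x : ι × α => x.1 = i)
        (ComputablePred.eq Computable.fst (Computable.const i))
        ((hf i).comp Computable.snd) ih).of_eq ?_
      rintro ⟨j, a⟩
      by_cases h : j = i
      · subst h; simp
      · simp [h]
  exact (key Finset.univ).of_eq fun x => by simp

theorem ComputablePred.of_finite_family {ι : Type*} [Primcodable ι] [Finite ι]
    {p : ι → α → Prop} (hp : ∀ i, ComputablePred (p i)) :
    ComputablePred fun x : ι × α => p x.1 x.2 := by
  classical
  exact ⟨inferInstance, Computable.of_finite_family (f := fun i a => decide (p i a))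
    fun i => (hp i).decide⟩

theorem ComputablePred.exists_le {p : α → ℕ → Prop} {b : α → ℕ}
    (hp : ComputablePred fun x : α × ℕ => p x.1 x.2) (hb : Computable b) :
    ComputablePred fun a => ∃ k ≤ b a, p a k := by
  classical
  -- After `n` rounds the candidates `k < n` are tested, hence `b a + 1` rounds.
  refine ⟨inferInstance, (Computable.nat_rec (σ := Bool) (f := fun a => b a + 1)
    (g := fun _ => false) (h := fun a y => y.2 || decide (p a y.1))
    (Computable.succ.comp hb) (Computable.const false) ?_).of_eq fun a => ?_⟩
  · exact Primrec.or.to_comp.comp (Computable.snd.comp Computable.snd)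
      (hp.comp (Computable.fst.pair (Computable.fst.comp Computable.snd))).decide
  · have : ∀ n, (Nat.rec (motive := fun _ => Bool) false (fun y IH => IH || decide (p a y)) n)
        = decide (∃ k < n, p a k) := by
      intro n
      induction n with
      | zero => simp
      | succ n ih =>
        simp only [ih, Nat.lt_succ_iff_lt_or_eq, or_and_right, exists_or, exists_eq_left,
          Bool.decide_or]
    exact (this (b a + 1)).trans (by simp only [Nat.lt_succ_iff])

end Computability

/-! ### Group numberings and their transport -/

/-- A numbering of the group `G` by codes in `α`, with computable multiplication and solvable word
problem. -/
structure GroupNumbering (G : Type*) [Group G] (α : Type*) [Primcodable α] where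
  /-- The element with a given code. -/
  val : α → G
  surjective_val : Function.Surjective val
  /-- The multiplication of codes. -/
  mul : α → α → α
  computable_mul : Computable₂ mul
  val_mul : ∀ a b, val (mul a b) = val a * val b
  computable_eq_one : ComputablePred fun a => val a = 1

namespace GroupNumbering

variable {G : Type*} [Group G] {α : Type*} [Primcodable α] (N : GroupNumbering G α)

/-- The cyclic membership problem is solvable with respect to the numbering. -/
def SolvesMembership : Prop :=
  ComputablePred fun p : α × α => N.val p.1 ∈ Subgroup.zpowers (N.val p.2)

/-- An inverse is found by search, since the word problem recognises it. -/
theorem exists_inv : ∃ f : α → α, Computable f ∧ ∀ a, N.val (f a) = (N.val a)⁻¹ := by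
  obtain ⟨f, hf, h⟩ := ComputablePred.exists_choice (q := fun a b => N.val (N.mul a b) = 1)
    (N.computable_eq_one.comp N.computable_mul) fun a => by
      obtain ⟨b, hb⟩ := N.surjective_val (N.val a)⁻¹
      exact ⟨b, by simp [N.val_mul, hb]⟩
  refine ⟨f, hf, fun a => ?_⟩
  rw [eq_comm, inv_eq_iff_mul_eq_one, ← N.val_mul, h]

theorem computable_eq {β : Type*} [Primcodable β] {f g : β → α} (hf : Computable f)
    (hg : Computable g) : ComputablePred fun b => N.val (f b) = N.val (g b) := by
  obtain ⟨i, hi, h⟩ := N.exists_inv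
  exact (N.computable_eq_one.comp (N.computable_mul.comp hf (hi.comp hg))).of_eq fun b => by
    rw [N.val_mul, h, mul_inv_eq_one]

theorem exists_pow : ∃ f : α × ℕ → α, Computable f ∧ ∀ a n, N.val (f (a, n)) = N.val a ^ n := by
  obtain ⟨e, he⟩ := N.surjective_val 1
  refine ⟨fun x => Nat.rec (motive := fun _ => α) e (fun _ y => N.mul y x.1) x.2,
    Computable.nat_rec Computable.snd (Computable.const e)
      (h := fun x y => N.mul y.2 x.1) ?_, fun a n => ?_⟩
  · exact N.computable_mul.comp (Computable.snd.comp Computable.snd)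
      (Computable.fst.comp Computable.fst)
  · induction n with
    | zero => simpa using he
    | succ n ih => simp only [N.val_mul, pow_succ] at ih ⊢; rw [ih]

/-- Integer exponents are coded as differences of two natural numbers, which makes them searchable.
-/
theorem exists_pow_div_pow : ∃ f : α × (ℕ × ℕ) → α,
    Computable f ∧ ∀ a m, N.val (f (a, m)) = N.val a ^ m.1 * (N.val a ^ m.2)⁻¹ := by
  obtain ⟨i, hi, hi'⟩ := N.exists_inv
  obtain ⟨p, hp, hp'⟩ := N.exists_pow
  refine ⟨fun x => N.mul (p (x.1, x.2.1)) (i (p (x.1, x.2.2))), ?_, fun a m => ?_⟩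
  · exact N.computable_mul.comp
      (hp.comp (Computable.fst.pair (Computable.fst.comp Computable.snd)))
      (hi.comp (hp.comp (Computable.fst.pair (Computable.snd.comp Computable.snd))))
  · simp only [N.val_mul, hi', hp']

/-- Reencoding of a numbering by natural numbers. -/
def toNat (a₀ : α) : GroupNumbering G ℕ where
  -- Numbers that decode to nothing are read as `a₀`. Codes in `ℕ` let the amalgam construction be
  -- iterated.
  val n := N.val ((Encodable.decode n).getD a₀)
  surjective_val g := by
    obtain ⟨a, rfl⟩ := N.surjective_val g
    exact ⟨Encodable.encode a, by simp⟩
  mul m n := Encodable.encode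
    (N.mul ((Encodable.decode m).getD a₀) ((Encodable.decode n).getD a₀))
  computable_mul := Computable.encode.comp (N.computable_mul.comp
    (Computable.option_getD (Computable.decode.comp Computable.fst) (Computable.const a₀))
    (Computable.option_getD (Computable.decode.comp Computable.snd) (Computable.const a₀)))
  val_mul m n := by simp [N.val_mul]
  computable_eq_one := N.computable_eq_one.comp
    (Computable.option_getD Computable.decode (Computable.const a₀))

variable {N} in
theorem SolvesMembership.toNat (h : N.SolvesMembership) (a₀ : α) :
    (N.toNat a₀).SolvesMembership :=
  ComputablePred.comp (p := fun p : α × α => N.val p.1 ∈ Subgroup.zpowers (N.val p.2)) h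
    (Computable.pair
    (Computable.option_getD (Computable.decode.comp Computable.fst) (Computable.const a₀))
    (Computable.option_getD (Computable.decode.comp Computable.snd) (Computable.const a₀)))

/-- Transport of a numbering along an isomorphism. -/
def mapEquiv {H : Type*} [Group H] (e : G ≃* H) : GroupNumbering H α where
  val a := e (N.val a)
  surjective_val := e.surjective.comp N.surjective_val
  mul := N.mul
  computable_mul := N.computable_mul
  val_mul a b := by simp [N.val_mul]
  computable_eq_one := N.computable_eq_one.of_eq fun a => by simp

variable {N} in
theorem SolvesMembership.mapEquiv {H : Type*} [Group H] (h : N.SolvesMembership) (e : G ≃* H) :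
    (N.mapEquiv e).SolvesMembership :=
  ComputablePred.of_eq h fun p => by
    simp only [GroupNumbering.mapEquiv, Subgroup.mem_zpowers_iff, ← map_zpow,
      EmbeddingLike.apply_eq_iff_eq]

/-- There are finitely many letters, so their codes may be chosen arbitrarily; the rest is a fold.
-/
theorem exists_code_wordValue {n : ℕ} (s : Fin n → G) :
    ∃ f : List (Fin n × Bool) → α, Computable f ∧ ∀ w, N.val (f w) = wordValue s w := by
  choose c hc using N.surjective_val
  refine ⟨fun w => w.foldr (fun x y => N.mul (c (if x.2 then s x.1 else (s x.1)⁻¹)) y) (c 1),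
    Computable.list_foldr Computable.id (Computable.const _)
      (h := fun _ (x : (Fin n × Bool) × α) => N.mul (c (if x.1.2 then s x.1.1 else (s x.1.1)⁻¹)) x.2)
      ?_, fun w => ?_⟩
  · refine N.computable_mul.comp (Computable.comp
      (f := fun x : Fin n × Bool => c (if x.2 then s x.1 else (s x.1)⁻¹))
      (Primrec.dom_finite _).to_comp (Computable.fst.comp Computable.snd))
      (Computable.snd.comp Computable.snd)
  · induction w with
    | nil => simp [wordValue, hc]
    | cons x w ih =>
      simp only [List.foldr_cons, N.val_mul, hc, ih]
      simp [wordValue]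

variable {N} in
theorem SolvesMembership.wordValue (h : N.SolvesMembership) {n : ℕ} (s : Fin n → G) :
    ComputablePred fun p : List (Fin n × Bool) × List (Fin n × Bool) =>
      wordValue s p.1 ∈ Subgroup.zpowers (wordValue s p.2) := by
  obtain ⟨f, hf, hv⟩ := N.exists_code_wordValue s
  exact (ComputablePred.comp h ((hf.comp Computable.fst).pair (hf.comp Computable.snd))).of_eq
    fun p => by simp only [hv]

end GroupNumbering

/-! ### Cyclic groups -/

theorem mem_zpowers_iff_pow_mul_inv {G : Type*} [Group G] {x y : G} :
    x ∈ Subgroup.zpowers y ↔ ∃ m : ℕ × ℕ, x = y ^ m.1 * (y ^ m.2)⁻¹ := by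
  constructor
  · rintro ⟨k, rfl⟩
    refine ⟨(k.toNat, (-k).toNat), ?_⟩
    simp only [← zpow_natCast, ← zpow_neg, ← zpow_add]
    congr 1
    omega
  · rintro ⟨m, rfl⟩
    exact mul_mem (pow_mem (Subgroup.mem_zpowers y) _)
      (inv_mem (pow_mem (Subgroup.mem_zpowers y) _))

/-- A numbering of a cyclic group by pairs of exponents of a generator. -/
theorem IsCyclic.exists_groupNumbering (G : Type*) [Group G] [IsCyclic G] :
    ∃ N : GroupNumbering G ℕ, N.SolvesMembership := by
  obtain ⟨g, hg⟩ := IsCyclic.exists_generator (α := G)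
  have hadd : Computable₂ fun x y : ℕ => x + y := Primrec.nat_add.to_comp
  have hmul : Computable₂ fun x y : ℕ => x * y := Primrec.nat_mul.to_comp
  -- For infinite order `orderOf g = 0`, and reduction modulo `0` is equality, so both cases are
  -- covered.
  have key : ∀ a b c d : ℕ, g ^ a * (g ^ b)⁻¹ = g ^ c * (g ^ d)⁻¹ ↔
      (a + d) % orderOf g = (c + b) % orderOf g := fun a b c d => by
    rw [← Nat.ModEq, ← pow_eq_pow_iff_modEq, mul_inv_eq_iff_eq_mul, mul_assoc,
      (Commute.pow_pow_self g d b).inv_left.eq, ← mul_assoc, eq_mul_inv_iff_mul_eq, pow_add,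
      pow_add]
  have hmod : ∀ {β : Type} [Primcodable β] {f h n : β → ℕ}, Computable f → Computable h →
      Computable n → ComputablePred fun b => f b % n b = h b % n b := fun hf hh hn =>
    ComputablePred.eq (Primrec.nat_mod.to_comp.comp hf hn) (Primrec.nat_mod.to_comp.comp hh hn)
  let N : GroupNumbering G (ℕ × ℕ) :=
    { val := fun m => g ^ m.1 * (g ^ m.2)⁻¹
      surjective_val := fun x => by
        obtain ⟨m, hm⟩ := mem_zpowers_iff_pow_mul_inv.1 (hg x)
        exact ⟨m, hm.symm⟩
      mul := fun m n => (m.1 + n.1, m.2 + n.2)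
      computable_mul :=
        (hadd.comp (Computable.fst.comp Computable.fst) (Computable.fst.comp Computable.snd)).pair
          (hadd.comp (Computable.snd.comp Computable.fst) (Computable.snd.comp Computable.snd))
      val_mul := fun m n => by
        simp only [← zpow_natCast, ← zpow_neg, ← zpow_add]
        congr 1
        push_cast
        ring
      computable_eq_one := (hmod Computable.fst Computable.snd
        (Computable.const (orderOf g))).of_eq fun m => by
          simpa [eq_comm] using (key m.1 m.2 0 0).symm }
  have hiff : ∀ p : (ℕ × ℕ) × (ℕ × ℕ), N.val p.1 ∈ Subgroup.zpowers (N.val p.2) ↔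
      ∃ k : ℕ × ℕ, (p.1.1 + (k.1 * p.2.2 + k.2 * p.2.1)) % orderOf g =
        ((k.1 * p.2.1 + k.2 * p.2.2) + p.1.2) % orderOf g := by
    rintro ⟨⟨a, b⟩, ⟨c, d⟩⟩
    rw [mem_zpowers_iff_pow_mul_inv]
    refine exists_congr fun k => ?_
    rw [← key]
    refine Eq.congr rfl ?_
    simp only [N, ← zpow_natCast, ← zpow_neg, ← zpow_add, ← zpow_mul]
    congr 1
    push_cast
    ring
  have hN : N.SolvesMembership := by
    -- Non-membership is certified by a `d` dividing the order of `g` and the exponent of the second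
    -- element, but not that of the first.
    refine ComputablePred.of_certificates
      (q := fun (p : (ℕ × ℕ) × (ℕ × ℕ)) (k : ℕ × ℕ) =>
        (p.1.1 + (k.1 * p.2.2 + k.2 * p.2.1)) % orderOf g =
          ((k.1 * p.2.1 + k.2 * p.2.2) + p.1.2) % orderOf g)
      (r := fun (p : (ℕ × ℕ) × (ℕ × ℕ)) (d : ℕ) => (orderOf g % d = 0 % d ∧
        p.2.1 % d = p.2.2 % d) ∧ ¬ p.1.1 % d = p.1.2 % d) ?_ ?_ ?_ ?_ ?_ ?_
    · have h11 : Computable fun x : ((ℕ × ℕ) × (ℕ × ℕ)) × (ℕ × ℕ) => x.1.1.1 :=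
        Computable.fst.comp (Computable.fst.comp Computable.fst)
      have h12 : Computable fun x : ((ℕ × ℕ) × (ℕ × ℕ)) × (ℕ × ℕ) => x.1.1.2 :=
        Computable.snd.comp (Computable.fst.comp Computable.fst)
      have h21 : Computable fun x : ((ℕ × ℕ) × (ℕ × ℕ)) × (ℕ × ℕ) => x.1.2.1 :=
        Computable.fst.comp (Computable.snd.comp Computable.fst)
      have h22 : Computable fun x : ((ℕ × ℕ) × (ℕ × ℕ)) × (ℕ × ℕ) => x.1.2.2 :=
        Computable.snd.comp (Computable.snd.comp Computable.fst)
      have hk1 : Computable fun x : ((ℕ × ℕ) × (ℕ × ℕ)) × (ℕ × ℕ) => x.2.1 :=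
        Computable.fst.comp Computable.snd
      have hk2 : Computable fun x : ((ℕ × ℕ) × (ℕ × ℕ)) × (ℕ × ℕ) => x.2.2 :=
        Computable.snd.comp Computable.snd
      exact hmod (hadd.comp h11 (hadd.comp (hmul.comp hk1 h22) (hmul.comp hk2 h21)))
        (hadd.comp (hadd.comp (hmul.comp hk1 h21) (hmul.comp hk2 h22)) h12) (Computable.const _)
    · refine ((hmod (Computable.const _) (Computable.const _) Computable.snd).and
        (hmod ?_ ?_ Computable.snd)).and (hmod ?_ ?_ Computable.snd).not
      · exact Computable.fst.comp (Computable.snd.comp Computable.fst)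
      · exact Computable.snd.comp (Computable.snd.comp Computable.fst)
      · exact Computable.fst.comp (Computable.fst.comp Computable.fst)
      · exact Computable.snd.comp (Computable.fst.comp Computable.fst)
    · exact fun p => (hiff p).1
    · rintro ⟨⟨a, b⟩, ⟨c, d⟩⟩ hp
      -- If the gcd divided `a - b`, Bézout would give an exponent proving membership.
      refine ⟨Int.gcd (orderOf g) (c - d), ⟨?_, ?_⟩, fun hab => hp ?_⟩
      · exact (Nat.modEq_zero_iff_dvd.2 (Int.natCast_dvd_natCast.1 (Int.gcd_dvd_left _ _)))
      · exact (Nat.modEq_iff_dvd.2 (Int.gcd_dvd_right _ _) : d ≡ c [MOD _]).symm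
      · obtain ⟨t, ht⟩ := Nat.modEq_iff_dvd.1 (Nat.ModEq.symm hab)
        rw [Int.gcd_eq_gcd_ab] at ht
        refine ⟨t * Int.gcdB (orderOf g) (c - d), ?_⟩
        have hab' : (a : ℤ) + -b = orderOf g * (Int.gcdA (orderOf g) (c - d) * t) +
            (c + -d) * (t * Int.gcdB (orderOf g) (c - d)) := by
          linear_combination ht
        simp only [N, ← zpow_natCast, ← zpow_neg, ← zpow_add, ← zpow_mul]
        rw [hab', zpow_add, zpow_mul g (orderOf g : ℤ), zpow_natCast, pow_orderOf_eq_one,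
          one_zpow, one_mul, zpow_mul]
    · exact fun p k hk => (hiff p).2 ⟨k, hk⟩
    · rintro ⟨⟨a, b⟩, ⟨c, d⟩⟩ δ ⟨⟨hn, hcd⟩, hab⟩ hp
      obtain ⟨⟨k₁, k₂⟩, hk⟩ := (hiff _).1 hp
      refine hab ?_
      have h1 := Nat.ModEq.of_dvd (Nat.modEq_zero_iff_dvd.1 hn) hk
      have hcd : c ≡ d [MOD δ] := hcd
      have h2 : k₁ * d + k₂ * c ≡ k₁ * c + k₂ * d [MOD δ] :=
        (hcd.symm.mul_left k₁).add (hcd.mul_left k₂)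
      refine Nat.ModEq.add_right_cancel h2 (h1.trans ?_)
      rw [add_comm]
  exact ⟨N.toNat (0, 0), hN.toNat _⟩

/-! ### Reduced lists and normal forms in an amalgam -/

open Monoid (PushoutI)

/-- Computable numberings of the factors of an amalgam, together with a numbering of the amalgamated
subgroup for which the embeddings are computable and have decidable ranges. -/
structure AmalgamNumbering {ι : Type*} [Primcodable ι] {P : ι → Type*} [∀ i, Group (P i)]
    {C : Type*} [Group C] (φ : ∀ i, C →* P i) where
  /-- The numberings of the factors. -/
  factor : ∀ i, GroupNumbering (P i) ℕ
  /-- The element of the amalgamated subgroup with a given code. -/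
  baseVal : ℕ → C
  /-- A code of the identity. -/
  one : ℕ
  baseVal_one : baseVal one = 1
  /-- The embeddings on codes. -/
  embed : ι × ℕ → ℕ
  computable_embed : Computable embed
  val_embed : ∀ i k, (factor i).val (embed (i, k)) = φ i (baseVal k)
  computable_mem_range : ComputablePred fun x : ι × ℕ => (factor x.1).val x.2 ∈ (φ x.1).range
  /-- The inverses of the embeddings on codes. -/
  restrict : ι × ℕ → ℕ
  computable_restrict : Computable restrict
  baseVal_restrict : ∀ i a, (factor i).val a ∈ (φ i).range →
    φ i (baseVal (restrict (i, a))) = (factor i).val a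

namespace AmalgamNumbering

variable {ι : Type*} [Primcodable ι] {P : ι → Type*} [∀ i, Group (P i)]
  {C : Type*} [Group C] {φ : ∀ i, C →* P i} (D : AmalgamNumbering φ)

/-- The element of a factor encoded by a syllable. -/
def syllable (x : ι × ℕ) : P x.1 := (D.factor x.1).val x.2

/-- The element of the amalgam encoded by a list of syllables. -/
def listVal (L : List (ι × ℕ)) : PushoutI φ :=
  (L.map fun x => PushoutI.of (φ := φ) x.1 (D.syllable x)).prod

@[simp]
theorem listVal_nil : D.listVal [] = 1 := rfl

@[simp]
theorem listVal_cons (x : ι × ℕ) (L : List (ι × ℕ)) :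
    D.listVal (x :: L) = PushoutI.of x.1 (D.syllable x) * D.listVal L := by
  simp [listVal]

@[simp]
theorem listVal_append (L L' : List (ι × ℕ)) :
    D.listVal (L ++ L') = D.listVal L * D.listVal L' := by
  simp [listVal]

theorem exists_syllable (i : ι) (g : P i) : ∃ a, D.syllable (i, a) = g :=
  (D.factor i).surjective_val g

/-- A list of syllables is reduced if no syllable lies in the amalgamated subgroup and adjacent
syllables lie in distinct factors. -/
def IsReduced (L : List (ι × ℕ)) : Prop :=
  (∀ x ∈ L, D.syllable x ∉ (φ x.1).range) ∧ (L.map Prod.fst).IsChain (· ≠ ·)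

theorem isReduced_nil : D.IsReduced [] := by simp [IsReduced]

variable {D} in
theorem IsReduced.tail {x : ι × ℕ} {L : List (ι × ℕ)} (h : D.IsReduced (x :: L)) :
    D.IsReduced L :=
  ⟨fun y hy => h.1 y (List.mem_cons_of_mem _ hy), by
    have := h.2
    rw [List.map_cons] at this
    exact this.tail⟩

variable {D} in
theorem IsReduced.exists_word {L : List (ι × ℕ)} (h : D.IsReduced L) :
    ∃ w : Monoid.CoprodI.Word P, PushoutI.Reduced φ w ∧
      PushoutI.ofCoprodI w.prod = D.listVal L ∧ w.toList.map Sigma.fst = L.map Prod.fst := by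
  refine ⟨⟨L.map fun x => ⟨x.1, D.syllable x⟩, ?_, ?_⟩, ?_, ?_, ?_⟩
  · simp only [List.mem_map]
    rintro _ ⟨x, hx, rfl⟩ h1
    exact h.1 x hx (by simp only at h1; rw [h1]; exact one_mem _)
  · have := h.2
    rw [List.isChain_map] at this ⊢
    exact this
  · intro g hg
    simp only [List.mem_map] at hg
    obtain ⟨x, hx, rfl⟩ := hg
    exact h.1 x hx
  · simp [Monoid.CoprodI.Word.prod, listVal, map_list_prod, Function.comp_def]
  · simp [Function.comp_def]

variable {D} in
/-- The sequence of factors of a reduced list depends only on the coset of its value. -/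
theorem IsReduced.map_fst_eq (hφ : ∀ i, Function.Injective (φ i)) {L L' : List (ι × ℕ)}
    (hL : D.IsReduced L) (hL' : D.IsReduced L') {h : C}
    (heq : D.listVal L = PushoutI.base φ h * D.listVal L') :
    L.map Prod.fst = L'.map Prod.fst := by
  classical
  obtain ⟨d⟩ := PushoutI.NormalWord.transversal_nonempty φ hφ
  obtain ⟨w, hw, hwv, hwf⟩ := hL.exists_word
  obtain ⟨w', hw', hwv', hwf'⟩ := hL'.exists_word
  obtain ⟨u, hu, huf⟩ := hw.exists_normalWord_prod_eq d
  obtain ⟨u', hu', huf'⟩ := hw'.exists_normalWord_prod_eq d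
  -- Normal words are determined by their products, and `h` acts on the head only, leaving the
  -- syllables alone.
  have : u = h • u' := PushoutI.NormalWord.prod_injective (by
    rw [PushoutI.NormalWord.prod_base_smul, hu, hu', hwv, hwv', heq])
  rw [← hwf, ← hwf', ← huf, ← huf', this]
  rfl

variable {D} in
-- The last syllable absorbs the factor from `C` and stays outside the range; only for the empty
-- list does it reappear on the left.
theorem IsReduced.exists_mul_base {L : List (ι × ℕ)} (hL : D.IsReduced L) (h : C) :
    ∃ h' L', D.IsReduced L' ∧ L'.map Prod.fst = L.map Prod.fst ∧
      D.listVal L * PushoutI.base φ h = PushoutI.base φ h' * D.listVal L' := by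
  induction L with
  | nil => exact ⟨h, [], D.isReduced_nil, rfl, by simp⟩
  | cons x L ih =>
    obtain ⟨h', L', hL', hf, hv⟩ := ih hL.tail
    obtain ⟨c, hc⟩ := D.exists_syllable x.1 (D.syllable x * φ x.1 h')
    refine ⟨1, (x.1, c) :: L', ⟨?_, ?_⟩, by simp [hf], ?_⟩
    · simp only [List.mem_cons, forall_eq_or_imp]
      refine ⟨?_, hL'.1⟩
      rw [hc, Subgroup.mul_mem_cancel_right _ (MonoidHom.mem_range.2 ⟨h', rfl⟩)]
      exact hL.1 x (by simp)
    · rw [List.map_cons, hf]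
      exact hL.2
    · rw [listVal_cons, mul_assoc, hv, map_one, one_mul, listVal_cons, hc, map_mul, ← mul_assoc,
        PushoutI.of_apply_eq_base]

/-- Multiplication of codes in the factors. -/
def mulCode (x : ι × ℕ × ℕ) : ℕ := (D.factor x.1).mul x.2.1 x.2.2

theorem computable_mulCode [Finite ι] : Computable D.mulCode :=
  Computable.of_finite_family (f := fun i (y : ℕ × ℕ) => (D.factor i).mul y.1 y.2)
    fun i => (D.factor i).computable_mul

theorem syllable_mulCode (i : ι) (a b : ℕ) :
    D.syllable (i, D.mulCode (i, a, b)) = D.syllable (i, a) * D.syllable (i, b) :=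
  (D.factor i).val_mul a b

variable [DecidableEq ι]

/-- Left multiplication by a syllable, absorbed into the first syllable of the list if it lies in
the same factor. -/
def absorb (x : ι × ℕ) (L : List (ι × ℕ)) : ℕ × List (ι × ℕ) :=
  L.head?.elim (x.2, L) fun z =>
    if x.1 = z.1 then (D.mulCode (x.1, x.2, z.2), L.tail) else (x.2, L)

theorem absorb_spec (x : ι × ℕ) {L : List (ι × ℕ)} (hL : D.IsReduced L) :
    D.IsReduced (D.absorb x L).2 ∧ (D.absorb x L).2.length ≤ L.length ∧
      (∀ z ∈ (D.absorb x L).2.head?, x.1 ≠ z.1) ∧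
      PushoutI.of x.1 (D.syllable (x.1, (D.absorb x L).1)) * D.listVal (D.absorb x L).2 =
        PushoutI.of x.1 (D.syllable x) * D.listVal L := by
  obtain ⟨i, a⟩ := x
  rcases L with _ | ⟨⟨j, b⟩, L⟩
  · simp [absorb, isReduced_nil]
  · by_cases hij : i = j
    · subst hij
      rw [show D.absorb (i, a) ((i, b) :: L) = (D.mulCode (i, a, b), L) by simp [absorb]]
      refine ⟨hL.tail, by simp, fun z hz => ?_, by
        simp only [D.syllable_mulCode, map_mul, listVal_cons, mul_assoc]⟩
      have := hL.2
      rcases L with _ | ⟨w, L⟩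
      · simp at hz
      · simp only [List.head?_cons, Option.mem_def, Option.some.injEq] at hz
        subst hz
        simp only [List.map_cons, List.isChain_cons_cons] at this
        exact this.1
    · rw [show D.absorb (i, a) ((j, b) :: L) = (a, (j, b) :: L) by simp [absorb, hij]]
      exact ⟨hL, le_rfl, by simpa using hij, rfl⟩

open Classical in
/-- Left multiplication by a syllable on the pairs consisting of a code of an element of the
amalgamated subgroup and a reduced list. -/
noncomputable def reduceStep (x : ι × ℕ) (s : ℕ × List (ι × ℕ)) : ℕ × List (ι × ℕ) :=
  -- The `C`-part is pushed into the factor of `x` and multiplied there. The result returns to `C`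
  -- if it lies in the range; otherwise it becomes the first syllable and the `C`-part is reset to
  -- `1`.
  let r := D.absorb (x.1, D.mulCode (x.1, x.2, D.embed (x.1, s.1))) s.2
  if (D.factor x.1).val r.1 ∈ (φ x.1).range then (D.restrict (x.1, r.1), r.2)
  else (D.one, (x.1, r.1) :: r.2)

theorem reduceStep_spec (x : ι × ℕ) (s : ℕ × List (ι × ℕ)) (hs : D.IsReduced s.2) :
    D.IsReduced (D.reduceStep x s).2 ∧ (D.reduceStep x s).2.length ≤ s.2.length + 1 ∧
      PushoutI.base φ (D.baseVal (D.reduceStep x s).1) * D.listVal (D.reduceStep x s).2 =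
        PushoutI.of x.1 (D.syllable x) *
          (PushoutI.base φ (D.baseVal s.1) * D.listVal s.2) := by
  obtain ⟨i, a⟩ := x
  obtain ⟨k, L⟩ := s
  obtain ⟨h1, h2, h3, h4⟩ := D.absorb_spec (i, D.mulCode (i, a, D.embed (i, k))) hs
  rw [D.syllable_mulCode, map_mul, mul_assoc] at h4
  rw [show D.syllable (i, D.embed (i, k)) = φ i (D.baseVal k) from D.val_embed i k,
    PushoutI.of_apply_eq_base] at h4
  simp only [reduceStep]
  generalize D.absorb (i, D.mulCode (i, a, D.embed (i, k))) L = r at h1 h2 h3 h4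
  dsimp only at h1 h2 h3 h4 ⊢
  rw [← h4]
  split_ifs with hr
  · refine ⟨h1, h2.trans (Nat.le_succ _), ?_⟩
    rw [← PushoutI.of_apply_eq_base φ i, D.baseVal_restrict i _ hr]
    rfl
  · refine ⟨⟨?_, ?_⟩, by simpa using h2, by simp [D.baseVal_one]⟩
    · simp only [List.mem_cons, forall_eq_or_imp]
      exact ⟨hr, h1.1⟩
    · obtain ⟨_, _ | ⟨z, M⟩⟩ := r
      · simp
      · have := h1.2
        simp only [List.map_cons, List.isChain_cons_cons] at this ⊢
        exact ⟨h3 z (by simp), this⟩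

/-- The normal form of a list of syllables. -/
noncomputable def reduce (L : List (ι × ℕ)) : ℕ × List (ι × ℕ) :=
  L.foldr D.reduceStep (D.one, [])

/-- The length bound is what makes the induction in `exists_conj` decrease. -/
theorem reduce_spec (L : List (ι × ℕ)) :
    D.IsReduced (D.reduce L).2 ∧ (D.reduce L).2.length ≤ L.length ∧
      PushoutI.base φ (D.baseVal (D.reduce L).1) * D.listVal (D.reduce L).2 = D.listVal L := by
  induction L with
  | nil => simp [reduce, isReduced_nil, D.baseVal_one]
  | cons x L ih =>
    obtain ⟨h1, h2, h3⟩ := ih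
    obtain ⟨h1', h2', h3'⟩ := D.reduceStep_spec x _ h1
    refine ⟨h1', ?_, ?_⟩
    · exact h2'.trans (by simpa using h2)
    · rw [listVal_cons, ← h3]
      exact h3'

/-- The sequence of factors of the normal form. -/
noncomputable def factors (L : List (ι × ℕ)) : List ι := (D.reduce L).2.map Prod.fst

/-- The computed normal form is reduced, so `IsReduced.map_fst_eq` compares it with any reduced list
for the same coset of `C`. -/
theorem factors_eq (hφ : ∀ i, Function.Injective (φ i)) {L L' : List (ι × ℕ)}
    (hL' : D.IsReduced L') {h : C} (heq : D.listVal L = PushoutI.base φ h * D.listVal L') :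
    D.factors L = L'.map Prod.fst := by
  obtain ⟨h1, -, h3⟩ := D.reduce_spec L
  refine h1.map_fst_eq hφ hL' (h := (D.baseVal (D.reduce L).1)⁻¹ * h) ?_
  rw [map_mul, mul_assoc, ← heq, ← h3, map_inv, inv_mul_cancel_left]

theorem listVal_eq_one_iff (hφ : ∀ i, Function.Injective (φ i)) (L : List (ι × ℕ)) :
    D.listVal L = 1 ↔ D.factors L = [] ∧ D.baseVal (D.reduce L).1 = 1 := by
  obtain ⟨h1, -, h3⟩ := D.reduce_spec L
  constructor
  · intro h
    have hf : D.factors L = [] := D.factors_eq hφ D.isReduced_nil (h := 1) (by simp [h])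
    refine ⟨hf, ?_⟩
    rw [factors, List.map_eq_nil_iff] at hf
    rw [hf, h, listVal_nil, mul_one] at h3
    exact (map_eq_one_iff _ (PushoutI.base_injective hφ)).1 h3
  · rintro ⟨hf, hb⟩
    rw [factors, List.map_eq_nil_iff] at hf
    rw [← h3, hf, hb]
    simp

/-- Together with the converse `exists_listVal_eq_of_factors`, this reads membership in a factor off
`factors`. -/
theorem factors_of_listVal_mem_factor (hφ : ∀ i, Function.Injective (φ i)) {L : List (ι × ℕ)}
    {i : ι} {g : P i} (h : D.listVal L = PushoutI.of i g) :
    D.factors L = [] ∨ D.factors L = [i] := by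
  by_cases hg : g ∈ (φ i).range
  · obtain ⟨c, rfl⟩ := hg
    left
    exact D.factors_eq hφ D.isReduced_nil (h := c)
      (by rw [h, PushoutI.of_apply_eq_base, listVal_nil, mul_one])
  · right
    obtain ⟨a, ha⟩ := D.exists_syllable i g
    refine D.factors_eq hφ (L' := [(i, a)]) ⟨?_, by simp⟩ (h := 1) (by simp [h, ha])
    simpa [ha] using hg

theorem exists_listVal_eq_of_factors {L : List (ι × ℕ)} {i : ι}
    (h : D.factors L = [] ∨ D.factors L = [i]) : ∃ b, D.listVal [(i, b)] = D.listVal L := by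
  obtain ⟨-, -, h3⟩ := D.reduce_spec L
  rw [← h3]
  rcases h with h | h
  · rw [factors, List.map_eq_nil_iff] at h
    exact ⟨D.embed (i, (D.reduce L).1), by
      rw [h, listVal_nil, mul_one, listVal_cons, listVal_nil, mul_one,
        ← PushoutI.of_apply_eq_base φ i, ← D.val_embed]
      rfl⟩
  · rw [factors, List.map_eq_singleton_iff] at h
    obtain ⟨⟨j, a⟩, h, rfl⟩ := h
    refine ⟨D.mulCode (j, D.embed (j, (D.reduce L).1), a), ?_⟩
    rw [h]
    simp only [listVal_cons, listVal_nil, mul_one, D.syllable_mulCode, map_mul]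
    rw [← PushoutI.of_apply_eq_base φ j, ← D.val_embed]
    rfl

/-- Every element of the amalgam is conjugate into a factor or to a cyclically reduced element. -/
theorem exists_conj [Nonempty ι] (L : List (ι × ℕ)) :
    ∃ K T, D.listVal T * D.listVal K = D.listVal K * D.listVal L ∧
      ((∃ i a, T = [(i, a)]) ∨ (D.factors T).head? ≠ (D.factors T).getLast?) := by
  induction hn : L.length using Nat.strong_induction_on generalizing L with
  | _ n ih =>
  obtain ⟨h1, h2, h3⟩ := D.reduce_spec L
  by_cases hends : (D.factors L).head? = (D.factors L).getLast?
  swap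
  · exact ⟨[], L, by simp, Or.inr hends⟩
  rcases hR : (D.reduce L).2 with _ | ⟨⟨i, a⟩, M⟩
  · obtain ⟨i⟩ := ‹Nonempty ι›
    obtain ⟨b, hb⟩ := D.exists_listVal_eq_of_factors (L := L) (i := i) (by simp [factors, hR])
    exact ⟨[], [(i, b)], by simpa using hb, Or.inl ⟨i, b, rfl⟩⟩
  rcases List.eq_nil_or_concat' M with rfl | ⟨M, ⟨j, b⟩, rfl⟩
  · obtain ⟨b, hb⟩ := D.exists_listVal_eq_of_factors (L := L) (i := i) (by simp [factors, hR])
    exact ⟨[], [(i, b)], by simpa using hb, Or.inl ⟨i, b, rfl⟩⟩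
  have hij : i = j := by
    simp only [factors, hR] at hends
    rw [List.map_cons, List.map_append, ← List.cons_append, List.map_singleton,
      List.getLast?_concat, List.cons_append, List.head?_cons] at hends
    exact Option.some.inj hends
  subst hij
  -- Conjugating by the last syllable brings it to the front, where it merges with the `C`-part and
  -- the first syllable into `c`; one syllable is saved.
  obtain ⟨c, hc⟩ := D.exists_syllable i
    (D.syllable (i, b) * φ i (D.baseVal (D.reduce L).1) * D.syllable (i, a))
  obtain ⟨K, T, hT, hT'⟩ := ih ((i, c) :: M).length (by
    rw [hR] at h2
    simp only [List.length_cons, List.length_append, List.length_nil] at h2 ⊢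
    omega) ((i, c) :: M) rfl
  refine ⟨K ++ [(i, b)], T, ?_, hT'⟩
  rw [listVal_append, ← mul_assoc, hT, ← h3, hR]
  simp only [listVal_cons, listVal_append, listVal_nil, mul_one, hc, map_mul,
    PushoutI.of_apply_eq_base, mul_assoc]

/-- The normal form of a power of a cyclically reduced element. -/
theorem factors_of_listVal_eq_pow (hφ : ∀ i, Function.Injective (φ i)) {T : List (ι × ℕ)}
    (hT : (D.factors T).head? ≠ (D.factors T).getLast?) {L : List (ι × ℕ)} {n : ℕ}
    (h : D.listVal L = D.listVal T ^ n) :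
    D.factors L = (List.replicate n (D.factors T)).flatten := by
  -- Copies of the normal form of `T` are concatenated, their `C`-parts being moved left. The
  -- junctions are reduced because the end factors of `T` differ.
  suffices ∃ h' L', D.IsReduced L' ∧ D.listVal T ^ n = PushoutI.base φ h' * D.listVal L' ∧
      L'.map Prod.fst = (List.replicate n (D.factors T)).flatten by
    obtain ⟨h', L', hL', hv, hf⟩ := this
    rw [D.factors_eq hφ hL' (h.trans hv), hf]
  clear h
  obtain ⟨h1, -, h3⟩ := D.reduce_spec T
  have hne : D.factors T ≠ [] := by
    rintro h
    simp [h] at hT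
  induction n with
  | zero => exact ⟨1, [], D.isReduced_nil, by simp, by simp⟩
  | succ n ih =>
    obtain ⟨h', L', hL', hv, hf⟩ := ih
    obtain ⟨h'', R, hR, hRf, hRv⟩ := h1.exists_mul_base h'
    refine ⟨D.baseVal (D.reduce T).1 * h'', R ++ L', ⟨?_, ?_⟩, ?_, ?_⟩
    · intro x hx
      rcases List.mem_append.1 hx with hx | hx
      · exact hR.1 x hx
      · exact hL'.1 x hx
    · rw [List.map_append, List.isChain_append]
      refine ⟨hR.2, hL'.2, fun x hx y hy => ?_⟩
      rw [hRf] at hx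
      rw [hf] at hy
      rintro rfl
      rcases n with _ | n
      · simp at hy
      · rw [List.replicate_succ, List.flatten_cons, List.head?_append_of_ne_nil _ hne] at hy
        exact hT (Option.mem_def.1 hy |>.trans (Option.mem_def.1 hx).symm)
    · rw [pow_succ', hv, listVal_append, map_mul, ← h3, mul_assoc, mul_assoc,
        ← mul_assoc (D.listVal _) (PushoutI.base φ h'), hRv, mul_assoc]
    · rw [List.map_append, hf, hRf, List.replicate_succ, List.flatten_cons]
      rfl

theorem le_length_factors_of_listVal_eq_pow (hφ : ∀ i, Function.Injective (φ i))
    {T : List (ι × ℕ)} (hT : (D.factors T).head? ≠ (D.factors T).getLast?) {L : List (ι × ℕ)}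
    {n : ℕ} (h : D.listVal L = D.listVal T ^ n) : n ≤ (D.factors L).length := by
  rw [D.factors_of_listVal_eq_pow hφ hT h]
  have hpos : 0 < (D.factors T).length := List.length_pos_iff.2 fun h => by simp [h] at hT
  simpa using Nat.le_mul_of_pos_right n hpos

end AmalgamNumbering

/-! ### Computable normal forms and cyclic membership in an amalgam -/

namespace AmalgamNumbering

variable {ι : Type*} [Primcodable ι] {P : ι → Type*} [∀ i, Group (P i)]
  {C : Type*} [Group C] {φ : ∀ i, C →* P i} (D : AmalgamNumbering φ) [DecidableEq ι] [Finite ι]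

theorem computable_absorb : Computable₂ D.absorb := by
  have hx : Computable fun y : ((ι × ℕ) × List (ι × ℕ)) × (ι × ℕ) => y.1.1 :=
    Computable.fst.comp Computable.fst
  refine (Computable.option_casesOn (o := fun p : (ι × ℕ) × List (ι × ℕ) => p.2.head?)
    (f := fun p => (p.1.2, p.2))
    (g := fun p z => if p.1.1 = z.1 then (D.mulCode (p.1.1, p.1.2, z.2), p.2.tail)
      else (p.1.2, p.2)) (Primrec.list_head?.to_comp.comp Computable.snd)
    ((Computable.snd.comp Computable.fst).pair Computable.snd) ?_).of_eq ?_
  · refine Computable.if_then_else ?_ ?_ ?_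
    · exact ComputablePred.eq (Computable.fst.comp hx) (Computable.fst.comp Computable.snd)
    · exact (D.computable_mulCode.comp ((Computable.fst.comp hx).pair
        ((Computable.snd.comp hx).pair (Computable.snd.comp Computable.snd)))).pair
        (Primrec.list_tail.to_comp.comp (Computable.snd.comp Computable.fst))
    · exact (Computable.snd.comp hx).pair (Computable.snd.comp Computable.fst)
  · rintro ⟨x, L⟩
    rcases L with _ | ⟨z, L⟩ <;> rfl

theorem computable_reduceStep : Computable₂ D.reduceStep := by
  classical
  have hi : Computable fun p : (ι × ℕ) × (ℕ × List (ι × ℕ)) => p.1.1 :=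
    Computable.fst.comp Computable.fst
  have hr : Computable fun p : (ι × ℕ) × (ℕ × List (ι × ℕ)) =>
      D.absorb (p.1.1, D.mulCode (p.1.1, p.1.2, D.embed (p.1.1, p.2.1))) p.2.2 :=
    D.computable_absorb.comp (hi.pair (D.computable_mulCode.comp (hi.pair
      ((Computable.snd.comp Computable.fst).pair (D.computable_embed.comp
        (hi.pair (Computable.fst.comp Computable.snd)))))))
      (Computable.snd.comp Computable.snd)
  have hir := hi.pair (Computable.fst.comp hr)
  refine (Computable.if_then_else (D.computable_mem_range.comp hir)
    ((D.computable_restrict.comp hir).pair (Computable.snd.comp hr))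
    ((Computable.const D.one).pair (Computable.list_cons.comp hir (Computable.snd.comp hr)))).of_eq
      fun p => ?_
  simp only [reduceStep]

theorem computable_reduce : Computable D.reduce :=
  Computable.list_foldr (h := fun _ x => D.reduceStep x.1 x.2) Computable.id (Computable.const _)
    (D.computable_reduceStep.comp (Computable.fst.comp Computable.snd)
      (Computable.snd.comp Computable.snd))

theorem computable_factors : Computable D.factors :=
  (Computable.list_map Computable.fst).comp (Computable.snd.comp D.computable_reduce)

/-- The numbering of an amalgam by lists of syllables. -/
noncomputable def toGroupNumbering [Nonempty ι] (hφ : ∀ i, Function.Injective (φ i)) :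
    GroupNumbering (PushoutI φ) (List (ι × ℕ)) where
  val := D.listVal
  surjective_val g := by
    induction g using PushoutI.induction_on with
    | of i g =>
      obtain ⟨a, rfl⟩ := D.exists_syllable i g
      exact ⟨[(i, a)], by simp⟩
    | base h =>
      obtain ⟨i⟩ := ‹Nonempty ι›
      obtain ⟨a, ha⟩ := D.exists_syllable i (φ i h)
      exact ⟨[(i, a)], by simp [ha, PushoutI.of_apply_eq_base]⟩
    | mul x y hx hy =>
      obtain ⟨L, rfl⟩ := hx
      obtain ⟨M, rfl⟩ := hy
      exact ⟨L ++ M, by simp⟩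
  mul := (· ++ ·)
  computable_mul := Computable.list_append
  val_mul := D.listVal_append
  computable_eq_one := by
    have hbase : ComputablePred fun k => D.baseVal k = 1 := by
      obtain ⟨i⟩ := ‹Nonempty ι›
      refine ((D.factor i).computable_eq_one.comp (D.computable_embed.comp
        ((Computable.const i).pair Computable.id))).of_eq fun k => ?_
      rw [id, D.val_embed, map_eq_one_iff _ (hφ i)]
    exact ((ComputablePred.eq D.computable_factors (Computable.const [])).and
      (hbase.comp (Computable.fst.comp D.computable_reduce))).of_eq fun L =>
        (D.listVal_eq_one_iff hφ L).symm

theorem solvesMembership_toGroupNumbering [Nonempty ι] (hφ : ∀ i, Function.Injective (φ i))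
    (hD : ∀ i, (D.factor i).SolvesMembership) : (D.toGroupNumbering hφ).SolvesMembership := by
  let N := D.toGroupNumbering hφ
  obtain ⟨inv, hinv, hinv'⟩ := N.exists_inv
  obtain ⟨pow, hpow, hpow'⟩ := N.exists_pow
  obtain ⟨pd, hpd, hpd'⟩ := N.exists_pow_div_pow
  have hbound : ComputablePred fun x : List (ι × ℕ) × List (ι × ℕ) =>
      ∃ k ≤ (D.factors x.1).length, N.val x.1 = N.val (pow (x.2, k)) :=
    ComputablePred.exists_le (p := fun x k => N.val x.1 = N.val (pow (x.2, k)))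
      (N.computable_eq (Computable.fst.comp Computable.fst)
        (hpow.comp ((Computable.snd.comp Computable.fst).pair Computable.snd)))
      (Computable.list_length.comp (D.computable_factors.comp Computable.fst))
  have hfac : ComputablePred fun x : ι × ℕ × ℕ =>
      (D.factor x.1).val x.2.2 ∈ Subgroup.zpowers ((D.factor x.1).val x.2.1) :=
    ComputablePred.of_finite_family (p := fun i (y : ℕ × ℕ) =>
      (D.factor i).val y.2 ∈ Subgroup.zpowers ((D.factor i).val y.1)) fun i =>
      ComputablePred.comp (p := fun p : ℕ × ℕ =>
        (D.factor i).val p.1 ∈ Subgroup.zpowers ((D.factor i).val p.2)) (hD i)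
        (Computable.snd.pair Computable.fst)
  have hconj : ∀ {A B A' B' K : PushoutI φ}, A' * K = K * A → B' * K = K * B →
      (A ∈ Subgroup.zpowers B ↔ A' ∈ Subgroup.zpowers B') := by
    intro A B A' B' K hA hB
    rw [← eq_mul_inv_iff_mul_eq] at hA hB
    rw [hA, hB, ← MulAut.conj_apply, ← MulAut.conj_apply, Subgroup.mem_zpowers_iff,
      Subgroup.mem_zpowers_iff]
    simp only [← map_zpow, EmbeddingLike.apply_eq_iff_eq]
  -- A negative certificate is `((K, T, R), (i, a, b))`, where `K` conjugates the second element to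
  -- `T` and the first to `R`. The length bound is tested on `R` and on its inverse to cover
  -- exponents of both signs.
  refine ComputablePred.of_certificates
    (q := fun (p : List (ι × ℕ) × List (ι × ℕ)) (k : ℕ × ℕ) => N.val p.1 = N.val (pd (p.2, k)))
    (r := fun (p : List (ι × ℕ) × List (ι × ℕ))
        (c : (List (ι × ℕ) × List (ι × ℕ) × List (ι × ℕ)) × (ι × ℕ × ℕ)) =>
      (N.val (c.1.2.1 ++ c.1.1) = N.val (c.1.1 ++ p.2) ∧
        N.val (c.1.2.2 ++ c.1.1) = N.val (c.1.1 ++ p.1)) ∧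
      ((¬ (D.factors c.1.2.1).head? = (D.factors c.1.2.1).getLast? ∧
          (¬ ∃ k ≤ (D.factors c.1.2.2).length, N.val c.1.2.2 = N.val (pow (c.1.2.1, k))) ∧
          ¬ ∃ k ≤ (D.factors (inv c.1.2.2)).length,
            N.val (inv c.1.2.2) = N.val (pow (c.1.2.1, k))) ∨
        (c.1.2.1 = [(c.2.1, c.2.2.1)] ∧
          ((c.1.2.2 = [(c.2.1, c.2.2.2)] ∧
            ¬ (D.factor c.2.1).val c.2.2.2 ∈ Subgroup.zpowers ((D.factor c.2.1).val c.2.2.1)) ∨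
          (¬ D.factors c.1.2.2 = [] ∧ ¬ D.factors c.1.2.2 = [c.2.1]))))) ?_ ?_ ?_ ?_ ?_ ?_
  · exact N.computable_eq (Computable.fst.comp Computable.fst)
      (hpd.comp ((Computable.snd.comp Computable.fst).pair Computable.snd))
  · let Cert := (List (ι × ℕ) × List (ι × ℕ)) ×
      ((List (ι × ℕ) × List (ι × ℕ) × List (ι × ℕ)) × (ι × ℕ × ℕ))
    have hL : Computable fun x : Cert => x.1.1 := Computable.fst.comp Computable.fst
    have hM : Computable fun x : Cert => x.1.2 := Computable.snd.comp Computable.fst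
    have hc1 : Computable fun x : Cert => x.2.1 := Computable.fst.comp Computable.snd
    have hK : Computable fun x : Cert => x.2.1.1 := Computable.fst.comp hc1
    have hT : Computable fun x : Cert => x.2.1.2.1 := Computable.fst.comp (Computable.snd.comp hc1)
    have hR : Computable fun x : Cert => x.2.1.2.2 := Computable.snd.comp (Computable.snd.comp hc1)
    have hc2 : Computable fun x : Cert => x.2.2 := Computable.snd.comp Computable.snd
    have hi : Computable fun x : Cert => x.2.2.1 := Computable.fst.comp hc2
    have ha : Computable fun x : Cert => x.2.2.2.1 := Computable.fst.comp (Computable.snd.comp hc2)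
    have hb : Computable fun x : Cert => x.2.2.2.2 := Computable.snd.comp (Computable.snd.comp hc2)
    have hsing : ∀ {β : Type _} [Primcodable β] {f : Cert → β}, Computable f →
        Computable fun x => [f x] := fun hf => Computable.list_cons.comp hf (Computable.const [])
    have hfT := D.computable_factors.comp hT
    have hfR := D.computable_factors.comp hR
    have hlast : Computable fun l : List ι => l.getLast? :=
      (Primrec.list_head?.to_comp.comp Computable.list_reverse).of_eq fun l => by simp
    exact ((N.computable_eq (Computable.list_append.comp hT hK)
        (Computable.list_append.comp hK hM)).and
      (N.computable_eq (Computable.list_append.comp hR hK)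
        (Computable.list_append.comp hK hL))).and
      (((ComputablePred.eq (Primrec.list_head?.to_comp.comp hfT) (hlast.comp hfT)).not.and
        ((hbound.comp (hR.pair hT)).not.and (hbound.comp ((hinv.comp hR).pair hT)).not)).or
      ((ComputablePred.eq hT (hsing (hi.pair ha))).and
        (((ComputablePred.eq hR (hsing (hi.pair hb))).and
          (hfac.comp (hi.pair (ha.pair hb))).not).or
        ((ComputablePred.eq hfR (Computable.const [])).not.and
          (ComputablePred.eq hfR (hsing hi)).not))))
  · rintro ⟨L, M⟩ h
    obtain ⟨k, hk⟩ := mem_zpowers_iff_pow_mul_inv.1 h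
    exact ⟨k, hk.trans (hpd' M k).symm⟩
  · rintro ⟨L, M⟩ h
    obtain ⟨K, T, hKT, hT⟩ := D.exists_conj M
    obtain ⟨R, hR⟩ := N.surjective_val (N.val K * N.val L * (N.val K)⁻¹)
    have hKR : N.val R * N.val K = N.val K * N.val L := by rw [hR]; group
    replace h : ¬ N.val R ∈ Subgroup.zpowers (N.val T) := fun h' => h ((hconj hKR hKT).2 h')
    have heqs : N.val (T ++ K) = N.val (K ++ M) ∧ N.val (R ++ K) = N.val (K ++ L) := by
      refine ⟨?_, ?_⟩
      · exact (N.val_mul T K).trans (hKT.trans (N.val_mul K M).symm)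
      · exact (N.val_mul R K).trans (hKR.trans (N.val_mul K L).symm)
    rcases hT with ⟨i, a, rfl⟩ | hT
    · by_cases hf : D.factors R = [] ∨ D.factors R = [i]
      · obtain ⟨b, hb⟩ := D.exists_listVal_eq_of_factors hf
        have hb : N.val [(i, b)] = N.val R := hb
        refine ⟨((K, [(i, a)], [(i, b)]), (i, a, b)), ⟨heqs.1, ?_⟩, Or.inr ⟨rfl, Or.inl ⟨rfl, ?_⟩⟩⟩
        · rw [← heqs.2]
          exact (N.val_mul _ _).trans ((congrArg (· * N.val K) hb).trans (N.val_mul _ _).symm)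
        · rintro ⟨k, hk⟩
          refine h ⟨k, ?_⟩
          rw [← hb]
          change D.listVal [(i, a)] ^ k = D.listVal [(i, b)]
          simp only [listVal_cons, listVal_nil, mul_one, ← map_zpow]
          exact congrArg _ hk
      · rw [not_or] at hf
        exact ⟨((K, [(i, a)], R), (i, a, a)), heqs, Or.inr ⟨rfl, Or.inr hf⟩⟩
    · obtain ⟨i⟩ := ‹Nonempty ι›
      -- The index and the two codes are placeholders in this branch.
      refine ⟨((K, T, R), (i, 0, 0)), heqs, Or.inl ⟨hT, ?_, ?_⟩⟩
      · rintro ⟨k, -, hk⟩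
        rw [hpow'] at hk
        exact h (hk ▸ pow_mem (Subgroup.mem_zpowers _) k)
      · rintro ⟨k, -, hk⟩
        rw [hpow', hinv'] at hk
        exact h (inv_mem_iff.1 (hk ▸ pow_mem (Subgroup.mem_zpowers _) k))
  · rintro ⟨L, M⟩ k hk
    exact mem_zpowers_iff_pow_mul_inv.2 ⟨k, hk.trans (hpd' M k)⟩
  · rintro ⟨L, M⟩ ⟨⟨K, T, R⟩, ⟨i, a, b⟩⟩ ⟨⟨hT, hR⟩, h⟩ hmem
    have hT : N.val T * N.val K = N.val K * N.val M :=
      (N.val_mul T K).symm.trans (hT.trans (N.val_mul K M))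
    have hR : N.val R * N.val K = N.val K * N.val L :=
      (N.val_mul R K).symm.trans (hR.trans (N.val_mul K L))
    have hmem : N.val R ∈ Subgroup.zpowers (N.val T) := (hconj hR hT).1 hmem
    rcases h with ⟨hcyc, h1, h2⟩ | ⟨hTa, h⟩
    · obtain ⟨k, hk⟩ := hmem
      obtain ⟨n, rfl | rfl⟩ := k.eq_nat_or_neg
      · have hk : N.val R = N.val T ^ n := by rw [← hk]; simp
        exact h1 ⟨n, D.le_length_factors_of_listVal_eq_pow hφ hcyc hk, by rw [hpow', hk]⟩
      · have hk : N.val (inv R) = N.val T ^ n := by rw [hinv', ← hk]; simp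
        exact h2 ⟨n, D.le_length_factors_of_listVal_eq_pow hφ hcyc hk, by rw [hpow', hk]⟩
    · have hTa : T = [(i, a)] := hTa
      subst hTa
      obtain ⟨k, hk⟩ := hmem
      have hk : D.listVal R = PushoutI.of i ((D.factor i).val a ^ k) := by
        rw [map_zpow]
        refine hk.symm.trans ?_
        change D.listVal [(i, a)] ^ k = _
        simp [syllable]
      rcases h with ⟨hRb, h⟩ | ⟨h1, h2⟩
      · have hRb : R = [(i, b)] := hRb
        subst hRb
        refine h ⟨k, ?_⟩
        simp only [listVal_cons, listVal_nil, mul_one] at hk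
        exact (PushoutI.of_injective hφ i hk).symm
      · exact (D.factors_of_listVal_mem_factor hφ hk).elim h1 h2

end AmalgamNumbering

/-! ### Amalgamation over a cyclic group and the conclusion -/

/-- An amalgam over a cyclic subgroup of groups with solvable cyclic membership problem has an
amalgam numbering. -/
theorem exists_amalgamNumbering {ι : Type*} [Primcodable ι] [Finite ι] {P : ι → Type*}
    [∀ i, Group (P i)] {C : Type*} [Group C] [IsCyclic C] {φ : ∀ i, C →* P i}
    (hP : ∀ i, ∃ N : GroupNumbering (P i) ℕ, N.SolvesMembership) :
    ∃ D : AmalgamNumbering φ, ∀ i, (D.factor i).SolvesMembership := by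
  choose N hN using hP
  obtain ⟨c, hc⟩ := IsCyclic.exists_generator (α := C)
  choose a ha using fun i => (N i).surjective_val (φ i c)
  choose pd hpd hpd' using fun i => (N i).exists_pow_div_pow
  let baseVal : ℕ → C := fun k => c ^ k.unpair.1 * (c ^ k.unpair.2)⁻¹
  have hsurj : ∀ x, ∃ k, baseVal k = x := fun x => by
    obtain ⟨m, hm⟩ := mem_zpowers_iff_pow_mul_inv.1 (hc x)
    exact ⟨Nat.pair m.1 m.2, by simp [baseVal, hm]⟩
  let embed : ι × ℕ → ℕ := fun x => pd x.1 (a x.1, x.2.unpair)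
  have hembed : Computable embed :=
    Computable.of_finite_family (f := fun i (k : ℕ) => pd i (a i, k.unpair)) fun i =>
      (hpd i).comp ((Computable.const (a i)).pair Computable.unpair)
  have hval : ∀ i k, (N i).val (embed (i, k)) = φ i (baseVal k) := fun i k => by
    simp [embed, baseVal, hpd', ha]
  -- The range of `φ i` is generated by `φ i c`, so this is a cyclic membership problem in the
  -- factor.
  have hmem : ComputablePred fun x : ι × ℕ => (N x.1).val x.2 ∈ (φ x.1).range := by
    refine ComputablePred.of_finite_family (p := fun i b => (N i).val b ∈ (φ i).range) fun i => ?_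
    refine (ComputablePred.comp (p := fun p : ℕ × ℕ =>
      (N i).val p.1 ∈ Subgroup.zpowers ((N i).val p.2)) (hN i)
      (Computable.id.pair (Computable.const (a i)))).of_eq fun b => ?_
    simp only [id, ha, Subgroup.mem_zpowers_iff, MonoidHom.mem_range, ← map_zpow]
    constructor
    · rintro ⟨k, hk⟩
      exact ⟨_, hk⟩
    · rintro ⟨x, hx⟩
      obtain ⟨k, rfl⟩ := hc x
      exact ⟨k, hx⟩
  have heq : ComputablePred fun x : (ι × ℕ) × ℕ =>
      (N x.1.1).val (embed (x.1.1, x.2)) = (N x.1.1).val x.1.2 :=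
    (ComputablePred.of_finite_family (p := fun i (y : ℕ × ℕ) =>
      (N i).val (embed (i, y.2)) = (N i).val y.1) fun i =>
      (N i).computable_eq (hembed.comp ((Computable.const i).pair Computable.snd))
        Computable.fst).comp (f := fun x : (ι × ℕ) × ℕ => (x.1.1, (x.1.2, x.2)))
      ((Computable.fst.comp Computable.fst).pair
        ((Computable.snd.comp Computable.fst).pair Computable.snd))
  -- The first alternative makes the relation total, so that the search for a preimage always stops.
  obtain ⟨restrict, hres, hres'⟩ := ComputablePred.exists_choice
    (q := fun (x : ι × ℕ) (k : ℕ) => ¬ (N x.1).val x.2 ∈ (φ x.1).range ∨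
      (N x.1).val (embed (x.1, k)) = (N x.1).val x.2)
    ((hmem.comp Computable.fst).not.or heq) fun x => by
      by_cases h : (N x.1).val x.2 ∈ (φ x.1).range
      · obtain ⟨y, hy⟩ := h
        obtain ⟨k, rfl⟩ := hsurj y
        exact ⟨k, Or.inr ((hval _ _).trans hy)⟩
      · exact ⟨0, Or.inl h⟩
  exact ⟨{
    factor := N
    baseVal := baseVal
    one := 0
    baseVal_one := by simp [baseVal]
    embed := embed
    computable_embed := hembed
    val_embed := hval
    computable_mem_range := hmem
    restrict := restrict
    computable_restrict := hres
    baseVal_restrict := fun i b hb => by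
      rw [← hval]
      exact (hres' (i, b)).resolve_left (not_not_intro hb) }, hN⟩

theorem Monoid.PushoutI.exists_groupNumbering {ι : Type*} [Primcodable ι] [Finite ι] [Nonempty ι]
    {P : ι → Type*} [∀ i, Group (P i)] {C : Type*} [Group C] [IsCyclic C] {φ : ∀ i, C →* P i}
    (hφ : ∀ i, Function.Injective (φ i))
    (hP : ∀ i, ∃ N : GroupNumbering (P i) ℕ, N.SolvesMembership) :
    ∃ N : GroupNumbering (PushoutI φ) ℕ, N.SolvesMembership := by
  classical
  obtain ⟨D, hD⟩ := exists_amalgamNumbering (φ := φ) hP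
  exact ⟨_, (D.solvesMembership_toGroupNumbering hφ hD).toNat []⟩

theorem Monoid.PushoutI.group_fg {ι : Type*} [Finite ι] [Nonempty ι] {P : ι → Type*}
    [∀ i, Group (P i)] {C : Type*} [Group C] {φ : ∀ i, C →* P i} (hP : ∀ i, Group.FG (P i)) :
    Group.FG (PushoutI φ) := by
  choose S hS hfin using fun i => Group.fg_iff.1 (hP i)
  refine Group.fg_iff.2 ⟨⋃ i, PushoutI.of i '' S i, ?_, Set.finite_iUnion fun i =>
    (hfin i).image _⟩
  rw [eq_top_iff]
  have hof : ∀ i (g : P i), PushoutI.of i g ∈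
      Subgroup.closure (⋃ i, PushoutI.of (φ := φ) i '' S i) := fun i g => by
    have hg : g ∈ Subgroup.closure (S i) := hS i ▸ Subgroup.mem_top g
    have := Subgroup.mem_map_of_mem (PushoutI.of (φ := φ) i) hg
    rw [MonoidHom.map_closure] at this
    exact Subgroup.closure_mono (Set.subset_iUnion (fun i => PushoutI.of (φ := φ) i '' S i) i) this
  intro x _
  induction x using PushoutI.induction_on with
  | of i g => exact hof i g
  | base h =>
    obtain ⟨i⟩ := ‹Nonempty ι›
    rw [← PushoutI.of_apply_eq_base φ i]
    exact hof i _
  | mul x y hx hy => exact mul_mem (hx trivial) (hy trivial)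

/-- A free product is an amalgam over the trivial group. -/
def Monoid.CoprodI.equivPushoutI {ι : Type*} (H : ι → Type*) [∀ i, Group (H i)] :
    Monoid.CoprodI H ≃* PushoutI (fun i => (1 : PUnit →* H i)) :=
  MonoidHom.toMulEquiv PushoutI.ofCoprodI
    (PushoutI.lift (fun _ => Monoid.CoprodI.of) 1 fun i => by ext; simp)
    (by ext; simp)
    (by
      apply PushoutI.hom_ext
      · intro i
        ext g
        simp
      · ext x
        exact (map_one (PushoutI.base _)).symm)

theorem IsCyclic.group_fg (G : Type*) [Group G] [IsCyclic G] : Group.FG G := by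
  obtain ⟨g, hg⟩ := IsCyclic.exists_generator (α := G)
  refine Group.fg_iff.2 ⟨{g}, ?_, Set.finite_singleton g⟩
  rw [← Subgroup.zpowers_eq_closure, eq_top_iff]
  exact fun x _ => hg x

theorem IsFreeProductOfCyclicGroups.exists_groupNumbering {G : Type*} [Group G]
    (hG : IsFreeProductOfCyclicGroups G) :
    Group.FG G ∧ ∃ N : GroupNumbering G ℕ, N.SolvesMembership := by
  obtain ⟨n, H, _, hH, ⟨e⟩⟩ := hG
  rcases n with _ | n
  -- The amalgam needs a nonempty index set; the empty free product is trivial, hence cyclic.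
  · have hid : MonoidHom.id (Monoid.CoprodI H) = 1 := Monoid.CoprodI.ext_hom _ _ fun i => i.elim0
    have : Subsingleton G := e.toEquiv.subsingleton_congr.2
      (subsingleton_of_forall_eq 1 fun x => DFunLike.congr_fun hid x)
    exact ⟨IsCyclic.group_fg G, IsCyclic.exists_groupNumbering G⟩
  · have e' := (e.trans (Monoid.CoprodI.equivPushoutI H)).symm
    have hfg : Group.FG (PushoutI (fun i => (1 : PUnit →* H i))) :=
      PushoutI.group_fg fun i => IsCyclic.group_fg (H i)
    obtain ⟨N, hN⟩ := PushoutI.exists_groupNumbering (φ := fun i => (1 : PUnit →* H i))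
      (fun i => Function.injective_of_subsingleton _) fun i => IsCyclic.exists_groupNumbering (H i)
    exact ⟨Group.fg_of_surjective (f := e'.toMonoidHom) e'.surjective, _, hN.mapEquiv e'⟩

theorem IsCyclicAmalgamOfFreeProductsOfCyclicGroups.exists_groupNumbering {G : Type*} [Group G]
    (hG : IsCyclicAmalgamOfFreeProductsOfCyclicGroups G) :
    Group.FG G ∧ ∃ N : GroupNumbering G ℕ, N.SolvesMembership := by
  obtain ⟨P, _, C, _, φ, hP, _, hφ, ⟨e⟩⟩ := hG
  have hfg : Group.FG (PushoutI φ) := PushoutI.group_fg fun b => (hP b).exists_groupNumbering.1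
  obtain ⟨N, hN⟩ := PushoutI.exists_groupNumbering hφ fun b => (hP b).exists_groupNumbering.2
  exact ⟨Group.fg_of_surjective (f := e.symm.toMonoidHom) e.symm.surjective, _,
    hN.mapEquiv e.symm⟩

theorem mainTheorem5 (G : Type u) [Group G]
    (hG : IsFreeProductOfCyclicGroups G ∨ IsCyclicAmalgamOfFreeProductsOfCyclicGroups G) :
    HasSolvableCyclicMembershipProblem G := by
  obtain ⟨hfg, N, hN⟩ : Group.FG G ∧ ∃ N : GroupNumbering G ℕ, N.SolvesMembership :=
    hG.elim (fun h => h.exists_groupNumbering) fun h => h.exists_groupNumbering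
  exact ⟨hfg, fun n s _ => hN.wordValue s⟩
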